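/- Let $G$ be a second-countable, locally compact, non-compact (Hausdorff) group with a left Haar measure $\mu$, let $1\le p<\infty$ and $S\subset G$. Let $\omega:G\to(0,\infty)$ be a locally $p$-integrable weight (i.e. $\int_K\omega^p\,d\mu<\infty$ for every compact $K\subset G$) that is $S$-admissible: $\operatorname{ess\,sup}_{t\in G}\frac{\omega(st)}{\omega(t)}<\infty$ for every $s\in S$. Let $L^p(G,\omega)$ be the space of (classes of) measurable functions $f:G\to\mathbb C$ with norm $\|f\|_{p,\omega}=\big(\int_G|f|^p\omega^p\,d\mu\big)^{1/p}<\infty$, and put $(T_sf)(t)=f(s^{-1}t)$. A vector $f\in L^p(G,\omega)$ is called $S$-dense if $\{T_sf: s\in S\}$ is dense in $L^p(G,\omega)$, and, for $\Gamma\subset\mathbb C$, $(\Gamma,S)$-dense if $\{\lambda T_sf:\lambda\in\Gamma,\ s\in S\}$ is dense in $L^p(G,\omega)$. Suppose that the subgroup generated by $S$ is abelian. Then: (1) There is an $S$-dense vector in $L^p(G,\omega)$ if and only if for every compact $F\subset G$ and every $\varepsilon>0$ there are $s\in S$ and a compact $E\subset F$ such that $\mu(F\setminus E)<\varepsilon$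 and $$\operatorname*{ess\,sup}_{t\in E}\omega(st)<\varepsilon,\qquad \operatorname*{ess\,sup}_{t\in E}\omega(s^{-1}t)<\varepsilon.$$ (2) There is a $([0,1],S)$-dense vector in $L^p(G,\omega)$ if and only if for every compact $F\subset G$ and every $\varepsilon>0$ there are $s\in S$ and a compact $E\subset F$ such that $\mu(F\setminus E)<\varepsilon$ and $$\operatorname*{ess\,sup}_{t\in E}\omega(s^{-1}t)<\varepsilon,\qquad \operatorname*{ess\,sup}_{t\in E}\omega(st)\cdot\operatorname*{ess\,sup}_{t\in E}\omega(s^{-1}t)<\varepsilon.$$ (3) There is a $([1,\infty),S)$-dense vector in $L^p(G,\omega)$ if and only if for every compact $F\subset G$ and every $\varepsilon>0$ there are $s\in S$ and a compact $E\subset F$ such that $\mu(F\setminus E)<\varepsilon$ and $$\operatorname*{ess\,sup}_{t\in E}\omega(st)<\varepsilon,\qquad \operatorname*{ess\,sup}_{t\in E}\omega(st)\cdot\operatorname*{ess\,sup}_{t\in E}\omega(s^{-1}t)<\varepsilon.$$ (4) There is a $(\mathbb C,S)$-dense vector in $L^p(G,\omega)$ if and only if for every compact $F\subset G$ and every $\varepsilon>0$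 there are $s\in S$ and a compact $E\subset F$ such that $\mu(F\setminus E)<\varepsilon$ and $$\operatorname*{ess\,sup}_{t\in E}\omega(st)\cdot\operatorname*{ess\,sup}_{t\in E}\omega(s^{-1}t)<\varepsilon.$$ (The essential supremum over a null set is $0$.) -/

import Mathlib

open MeasureTheory
open scoped ENNReal

noncomputable section

namespace WeightedTranslates

variable {G : Type*} [Group G] [TopologicalSpace G] [MeasurableSpace G]

/-- `ω` is a (locally `p`-integrable) weight on `G`: it is strictly positive and `ω ^ p` is locally
integrable (which includes its almost everywhere measurability). -/
def IsWeight (μ : Measure G) (p : ℝ≥0∞) (ω : G → ℝ) : Prop :=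
  (∀ t, 0 < ω t) ∧ LocallyIntegrable (fun t => ω t ^ p.toReal) μ

/-- `M(s) = ess sup_{t ∈ G} ω(st) / ω(t)`, with values in `[0, ∞]`. -/
def translationBound (μ : Measure G) (ω : G → ℝ) (s : G) : ℝ≥0∞ :=
  essSup (fun t => ENNReal.ofReal (ω (s * t) / ω t)) μ

/-- `ω` is `S`-admissible: `M(s) < ∞` for every `s ∈ S`. -/
def IsAdmissible (μ : Measure G) (S : Set G) (ω : G → ℝ) : Prop :=
  ∀ s ∈ S, translationBound μ ω s < ∞

/-- The measure `ω ^ p dμ`. -/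
def weightedMeasure (μ : Measure G) (p : ℝ≥0∞) (ω : G → ℝ) : Measure G :=
  μ.withDensity fun t => ENNReal.ofReal (ω t ^ p.toReal)

/-- The weighted space `L^p(G, ω)`: classes of measurable `f : G → ℂ` with
`∫ |f| ^ p ω ^ p dμ < ∞`, normed by the `p`-th root of this integral. For a weight `ω` the measures
`μ` and `ω ^ p dμ` have the same null sets. -/
abbrev WeightedLp (μ : Measure G) (p : ℝ≥0∞) (ω : G → ℝ) :=
  Lp ℂ p (weightedMeasure μ p ω)

/-- The orbit `{T_s f : s ∈ S}` in `L^p(G, ω)`, where `(T_s f)(t) = f(s⁻¹ t)`. -/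
def orbit (μ : Measure G) (p : ℝ≥0∞) (ω : G → ℝ) (S : Set G) (f : WeightedLp μ p ω) :
    Set (WeightedLp μ p ω) :=
  {g | ∃ s ∈ S, g =ᵐ[μ] fun t => f (s⁻¹ * t)}

/-- The orbit `{c T_s f : c ∈ Γ, s ∈ S}` in `L^p(G, ω)`, where `(T_s f)(t) = f(s⁻¹ t)`. -/
def scaledOrbit (μ : Measure G) (p : ℝ≥0∞) (ω : G → ℝ) (Γ : Set ℂ) (S : Set G)
    (f : WeightedLp μ p ω) : Set (WeightedLp μ p ω) :=
  {g | ∃ c ∈ Γ, ∃ s ∈ S, g =ᵐ[μ] fun t => c * f (s⁻¹ * t)}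

/-- There is an `S`-dense vector in `L^p(G, ω)`. -/
def HasDenseVector (μ : Measure G) (p : ℝ≥0∞) [Fact (1 ≤ p)] (ω : G → ℝ) (S : Set G) : Prop :=
  ∃ f : WeightedLp μ p ω, Dense (orbit μ p ω S f)

/-- There is a `(Γ, S)`-dense vector in `L^p(G, ω)`. -/
def HasScaledDenseVector (μ : Measure G) (p : ℝ≥0∞) [Fact (1 ≤ p)] (ω : G → ℝ) (Γ : Set ℂ)
    (S : Set G) : Prop :=
  ∃ f : WeightedLp μ p ω, Dense (scaledOrbit μ p ω Γ S f)

/-- `ess sup_{t ∈ E} ω(st)`, with values in `[0, ∞]` (it is `0` when `μ E = 0`). -/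
def essSupTranslate (μ : Measure G) (ω : G → ℝ) (E : Set G) (s : G) : ℝ≥0∞ :=
  essSup (fun t => ENNReal.ofReal (ω (s * t))) (μ.restrict E)

end WeightedTranslates

end

/-! All four parts are instances of one equivalence: for any set Γ of scalars, a (Γ, S)-dense vector
exists iff `ScaledCriterion` holds, i.e. some nonzero c ∈ Γ and s ∈ S make ω(s·) ≤ ε/|c| and ω(s⁻¹·)
≤ ε|c| on most of any given compact set.

Sufficiency is Birkhoff transitivity for the operators c T_s. For f, g in C_c and E ⊆ supp f ∪ supp
g from the criterion, the vector u = 1_E f + c⁻¹ (1_E g)(s·) is close to f, and c T_s u = c T_s(1_E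
f) + 1_E g is close to g (`ScaledCriterion.exists_approx`).

Necessity is where commutativity enters: c T_s has dense range and commutes with the other
translations, so it maps vectors with dense orbit to vectors with dense orbit. Hence some h ≈ 1_F
satisfies c T_s h ≈ 1_F (`exists_approx_of_dense`). If sF almost misses F, then c T_s h is small on
sF though h ≈ 1 on F, which forces ω(s·) to be small; h on s⁻¹F controls ω(s⁻¹·) in the same way.
The separation of F and sF comes from non-compactness (`exists_approx_indicator_of_dense`):
approximating 1_F + κ 1_H, with H far from F and κ small, would otherwise put contradictory bounds
on |c|.

Finally c is eliminated: the two bounds multiply to ε², and conversely a small product can be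
balanced by a suitable c > 0 (`exists_balancing_scalar`, `scaledCriterion_iff`). -/

namespace WeightedTranslates

open Filter Topology Set
open scoped Pointwise

set_option linter.unusedSectionVars false

/-! ### Topological transitivity -/

section Baire

/-- Birkhoff's transitivity theorem for a family of continuous maps: if the family is transitive,
then some point has a dense orbit. -/
theorem exists_dense_range_of_transitive {X ι : Type*} [TopologicalSpace X] [BaireSpace X]
    [SecondCountableTopology X] [Nonempty X] (L : ι → X → X) (hL : ∀ i, Continuous (L i))
    (htrans : ∀ U V : Set X, IsOpen U → IsOpen V → U.Nonempty → V.Nonempty →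
      ∃ i, ∃ u ∈ U, L i u ∈ V) :
    ∃ x, Dense (range fun i => L i x) := by
  have hB := TopologicalSpace.isBasis_countableBasis X
  -- A point of this countable intersection of dense open sets has an orbit meeting every basic open
  -- set.
  have hd : Dense (⋂ V ∈ TopologicalSpace.countableBasis X, ⋃ i, L i ⁻¹' V) := by
    refine dense_biInter_of_isOpen (fun V hV => ?_) (TopologicalSpace.countable_countableBasis X)
      (fun V hV => ?_)
    · exact isOpen_iUnion fun i => (hB.isOpen hV).preimage (hL i)
    · rw [dense_iff_inter_open]
      intro U hU hUne
      obtain ⟨i, u, hu, hiu⟩ := htrans U V hU (hB.isOpen hV) hUne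
        (TopologicalSpace.nonempty_of_mem_countableBasis hV)
      exact ⟨u, hu, mem_iUnion.2 ⟨i, hiu⟩⟩
  obtain ⟨x, hx⟩ := hd.nonempty
  refine ⟨x, hB.dense_iff.2 fun V hV _ => ?_⟩
  obtain ⟨i, hi⟩ := mem_iUnion.1 (mem_iInter₂.1 hx V hV)
  exact ⟨_, hi, i, rfl⟩

end Baire

theorem toReal_pos_of_one_le {p : ℝ≥0∞} (hp1 : 1 ≤ p) (hp : p ≠ ∞) : 0 < p.toReal :=
  ENNReal.toReal_pos (zero_lt_one.trans_le hp1).ne' hp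

/-! ### Composition operators on L^p -/

section Composition

variable {α : Type*} [MeasurableSpace α] {ν : Measure α} {p : ℝ≥0∞} [Fact (1 ≤ p)]

/-- Composition with a nonsingular map, as a bounded linear operator on `L^p`. -/
noncomputable def lpComp (φ : α → α) (hφ : ∀ P : α → Prop, (∀ᵐ t ∂ν, P t) → ∀ᵐ t ∂ν, P (φ t))
    (hmem : ∀ f : α → ℂ, MemLp f p ν → MemLp (fun t => f (φ t)) p ν) (C : ℝ≥0∞) (hC : C ≠ ∞)
    (hbound : ∀ f : α → ℂ, eLpNorm (fun t => f (φ t)) p ν ≤ C * eLpNorm f p ν) :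
    Lp ℂ p ν →L[ℂ] Lp ℂ p ν :=
  LinearMap.mkContinuous
    { toFun := fun f => (hmem f (Lp.memLp f)).toLp
      map_add' := fun f g => by
        apply Lp.ext
        filter_upwards [(hmem _ (Lp.memLp (f + g))).coeFn_toLp, (hmem _ (Lp.memLp f)).coeFn_toLp,
          (hmem _ (Lp.memLp g)).coeFn_toLp, Lp.coeFn_add (hmem _ (Lp.memLp f)).toLp
          (hmem _ (Lp.memLp g)).toLp, hφ _ (Lp.coeFn_add f g)] with t h1 h2 h3 h4 h5
        rw [h1, h4, Pi.add_apply, h2, h3, h5, Pi.add_apply]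
      map_smul' := fun c f => by
        apply Lp.ext
        filter_upwards [(hmem _ (Lp.memLp (c • f))).coeFn_toLp, (hmem _ (Lp.memLp f)).coeFn_toLp,
          Lp.coeFn_smul c (hmem _ (Lp.memLp f)).toLp, hφ _ (Lp.coeFn_smul c f)] with t h1 h2 h3 h4
        rw [h1, RingHom.id_apply, h3, Pi.smul_apply, h2, h4, Pi.smul_apply] }
    C.toReal fun f => by
      refine (Lp.norm_toLp _ (hmem f (Lp.memLp f))).trans_le ?_
      rw [Lp.norm_def, ← ENNReal.toReal_mul]
      exact ENNReal.toReal_mono (ENNReal.mul_ne_top hC (Lp.eLpNorm_ne_top f)) (hbound f)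

end Composition

variable {G : Type*} [Group G] [TopologicalSpace G] [IsTopologicalGroup G]
    [LocallyCompactSpace G] [SecondCountableTopology G]
    [MeasurableSpace G] [BorelSpace G] {μ : Measure G} [μ.IsHaarMeasure]
    {p : ℝ≥0∞} [hp1 : Fact (1 ≤ p)] {S : Set G} {ω : G → ℝ}

/-! ### Comparison of μ with the weighted measure and norm -/

section Weight
variable (hω : IsWeight μ p ω)
include hω

theorem IsWeight.aemeasurable_density :
    AEMeasurable (fun t => ENNReal.ofReal (ω t ^ p.toReal)) μ :=
  hω.2.aestronglyMeasurable.aemeasurable.ennreal_ofReal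

theorem IsWeight.aemeasurable (hp : p ≠ ∞) : AEMeasurable ω μ := by
  have h := hω.2.aestronglyMeasurable.aemeasurable.pow_const (p.toReal⁻¹)
  refine h.congr (.of_forall fun t => ?_)
  simp only
  rw [← Real.rpow_mul (hω.1 t).le, mul_inv_cancel₀ (toReal_pos_of_one_le hp1.out hp).ne',
    Real.rpow_one]

theorem IsWeight.density_ne_zero (t : G) : ENNReal.ofReal (ω t ^ p.toReal) ≠ 0 :=
  (ENNReal.ofReal_pos.2 (Real.rpow_pos_of_pos (hω.1 t) _)).ne'

theorem IsWeight.absolutelyContinuous : μ ≪ weightedMeasure μ p ω :=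
  withDensity_absolutelyContinuous' hω.aemeasurable_density
    (.of_forall hω.density_ne_zero)

theorem weightedMeasure_absolutelyContinuous : weightedMeasure μ p ω ≪ μ :=
  withDensity_absolutelyContinuous _ _

theorem IsWeight.ae_eq : ae (weightedMeasure μ p ω) = ae μ :=
  le_antisymm (weightedMeasure_absolutelyContinuous hω).ae_le hω.absolutelyContinuous.ae_le

theorem IsWeight.weightedMeasure_lt_top {F : Set G} (hF : IsCompact F) :
    weightedMeasure μ p ω F < ∞ := by
  have h := (hω.2.integrableOn_isCompact hF).lintegral_lt_top
  rw [weightedMeasure, withDensity_apply' _ F]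
  exact h

theorem IsWeight.isLocallyFiniteMeasure : IsLocallyFiniteMeasure (weightedMeasure μ p ω) := by
  refine ⟨fun x => ?_⟩
  obtain ⟨K, hK, hx⟩ := exists_compact_mem_nhds x
  exact ⟨K, hx, hω.weightedMeasure_lt_top hK⟩

/-- The norm of `L^p(G, ω)` in terms of `μ`. -/
theorem IsWeight.eLpNorm_eq (hp : p ≠ ∞) (f : G → ℂ) :
    eLpNorm f p (weightedMeasure μ p ω) = eLpNorm (fun t => ω t • f t) p μ := by
  have hp0 : p ≠ 0 := (zero_lt_one.trans_le hp1.out).ne'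
  rw [eLpNorm_eq_lintegral_rpow_enorm_toReal hp0 hp, eLpNorm_eq_lintegral_rpow_enorm_toReal hp0 hp,
    weightedMeasure, lintegral_withDensity_eq_lintegral_mul_non_measurable₀ _
      hω.aemeasurable_density (.of_forall fun _ => ENNReal.ofReal_lt_top)]
  congr 1
  refine lintegral_congr fun t => ?_
  rw [enorm_smul, ENNReal.mul_rpow_of_nonneg _ _ (toReal_pos_of_one_le hp1.out hp).le,
    Real.enorm_eq_ofReal (hω.1 t).le, ENNReal.ofReal_rpow_of_pos (hω.1 t)]
  rfl

theorem eLpNorm_comp_mul_left {f : G → ℂ} (s : G) :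
    eLpNorm (fun t => f (s * t)) p μ = eLpNorm f p μ := by
  conv_rhs => rw [← map_mul_left_eq_self μ s,
    (measurableEmbedding_mulLeft s).eLpNorm_map_measure]
  rfl

/-- The norm of a translate in `L^p(G, ω)` in terms of `μ`. -/
theorem IsWeight.eLpNorm_translate_eq (hp : p ≠ ∞) (f : G → ℂ) (s : G) :
    eLpNorm (fun t => f (s⁻¹ * t)) p (weightedMeasure μ p ω) =
      eLpNorm (fun t => ω (s * t) • f t) p μ := by
  rw [hω.eLpNorm_eq hp, ← eLpNorm_comp_mul_left hω s]
  simp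

/-- A translate of a bounded function supported on a set where the translate of the weight is
small has small norm. -/
theorem IsWeight.eLpNorm_translate_le (hp : p ≠ ∞) {f : G → ℂ} {s : G} {E : Set G}
    {C b : ℝ} (hC : ∀ t, ‖f t‖ ≤ C) (hb0 : 0 ≤ b) (hfE : ∀ t ∉ E, f t = 0)
    (hb : essSupTranslate μ ω E s ≤ ENNReal.ofReal b) :
    eLpNorm (fun t => f (s⁻¹ * t)) p (weightedMeasure μ p ω) ≤
      μ E ^ p.toReal⁻¹ * ENNReal.ofReal (b * C) := by
  rw [hω.eLpNorm_translate_eq hp, ← eLpNorm_restrict_eq_of_support_subset (s := E)]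
  · refine (eLpNorm_le_of_ae_bound (C := b * C) ?_).trans (by simp)
    filter_upwards [ae_le_essSup (μ := μ.restrict E) (f := fun t => ENNReal.ofReal (ω (s * t)))] with t ht
    have h1 : ω (s * t) ≤ b := (ENNReal.ofReal_le_ofReal_iff hb0).1 (ht.trans hb)
    rw [norm_smul, Real.norm_of_nonneg (hω.1 _).le]
    exact mul_le_mul h1 (hC t) (norm_nonneg _) hb0
  · intro t ht
    by_contra h
    exact ht (by simp [hfE t h])

/-- Absolute continuity of the integral of ω^p, which is finite over the compact set F. -/
theorem IsWeight.exists_forall_weightedMeasure_lt {F : Set G} (hF : IsCompact F) {ε : ℝ≥0∞}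
    (hε : ε ≠ 0) :
    ∃ δ > 0, ∀ A ⊆ F, μ A < δ → weightedMeasure μ p ω A < ε := by
  have h := (hω.weightedMeasure_lt_top hF).ne
  rw [weightedMeasure, withDensity_apply' _ F] at h
  obtain ⟨δ, hδ, H⟩ := exists_pos_setLIntegral_lt_of_measure_lt h hε
  refine ⟨δ, hδ, fun A hAF hA => ?_⟩
  have := H A ((Measure.restrict_apply_le _ _).trans_lt hA)
  rw [Measure.restrict_restrict_of_subset hAF] at this
  rwa [weightedMeasure, withDensity_apply' _ A]

/-- Small sets for the weighted measure are small for `μ` on a compact set. -/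
theorem IsWeight.exists_forall_measure_lt [T2Space G] {F : Set G} (hF : IsCompact F) {ε : ℝ≥0∞}
    (hε : ε ≠ 0) :
    ∃ δ > 0, ∀ A, weightedMeasure μ p ω A < δ → μ (F ∩ A) < ε := by
  -- μ has density ω⁻ᵖ with respect to the weighted measure, so absolute continuity of the integral
  -- applies with the roles exchanged.
  have hinv := withDensity_inv_same₀ hω.aemeasurable_density (.of_forall hω.density_ne_zero)
    (.of_forall fun _ => ENNReal.ofReal_ne_top)
  change (weightedMeasure μ p ω).withDensity _ = μ at hinv
  have := hω.isLocallyFiniteMeasure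
  have h := hF.measure_lt_top (μ := μ).ne
  nth_rw 1 [← hinv] at h
  rw [withDensity_apply' _ F] at h
  obtain ⟨δ, hδ, H⟩ := exists_pos_setLIntegral_lt_of_measure_lt h hε
  refine ⟨δ, hδ, fun A hA => ?_⟩
  have := H A ((Measure.restrict_apply_le _ _).trans_lt hA)
  rw [Measure.restrict_restrict' hF.measurableSet, inter_comm, ← withDensity_apply' _ (F ∩ A),
    hinv] at this
  exact this

/-- Convergence in the norm of `L^p(G, ω)` implies convergence in measure on compact sets. -/
theorem IsWeight.exists_forall_measure_enorm_ge_lt [T2Space G] (hp : p ≠ ∞) {F : Set G}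
    (hF : IsCompact F) {r η : ℝ} (hr : 0 < r) (hη : 0 < η) :
    ∃ δ > (0 : ℝ≥0∞), ∀ k : G → ℂ, AEStronglyMeasurable k μ →
      eLpNorm k p (weightedMeasure μ p ω) < δ →
        μ (F ∩ {t | r ≤ ‖k t‖}) < ENNReal.ofReal η := by
  have hp0 : p ≠ 0 := (zero_lt_one.trans_le hp1.out).ne'
  have hpr := toReal_pos_of_one_le hp1.out hp
  obtain ⟨δ, hδ, H⟩ := hω.exists_forall_measure_lt hF (ENNReal.ofReal_pos.2 hη).ne'
  have hr' : ENNReal.ofReal r ≠ 0 := (ENNReal.ofReal_pos.2 hr).ne'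
  have hrp : ENNReal.ofReal r ^ p.toReal ≠ 0 := (ENNReal.rpow_pos (pos_iff_ne_zero.2 hr')
    ENNReal.ofReal_ne_top).ne'
  have hrp' : ENNReal.ofReal r ^ p.toReal ≠ ∞ :=
    ENNReal.rpow_ne_top_of_nonneg hpr.le ENNReal.ofReal_ne_top
  -- This threshold makes Chebyshev's bound r⁻ᵖ ‖k‖ᵖ smaller than δ.
  refine ⟨(δ * ENNReal.ofReal r ^ p.toReal) ^ p.toReal⁻¹, ?_, fun k hk hkδ => ?_⟩
  · refine ENNReal.rpow_pos_of_nonneg (by simp [pos_iff_ne_zero, hδ.ne', hrp]) (by positivity)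
  have hset : {t | r ≤ ‖k t‖} = {t | ENNReal.ofReal r ≤ ‖k t‖ₑ} := by
    ext t
    simp only [mem_ofPred_eq, ← ofReal_norm]
    rw [ENNReal.ofReal_le_ofReal_iff (norm_nonneg _)]
  rw [hset]
  refine H _ ((meas_ge_le_mul_pow_eLpNorm_enorm _ hp0 hp
    (hk.mono_ac (weightedMeasure_absolutelyContinuous hω)) hr' (by simp)).trans_lt ?_)
  have := (ENNReal.lt_rpow_inv_iff hpr).1 hkδ
  rw [ENNReal.inv_rpow, mul_comm, ← div_eq_mul_inv]
  exact (ENNReal.div_lt_iff (.inl hrp) (.inl hrp')).2 this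

/-- If the translate by `s` of `k` is bounded below on `D`, then the translate of the weight is
small on most of `D`. -/
theorem IsWeight.measure_translate_ge_le (hp : p ≠ ∞) {k : G → ℂ} (hk : AEStronglyMeasurable k μ)
    {D : Set G} {s : G} {b c : ℝ} (hb : 0 < b) (hc : 0 < c) (hD : ∀ t ∈ D, c ≤ ‖k (s * t)‖) :
    μ {t ∈ D | b ≤ ω (s * t)} ≤
      (ENNReal.ofReal (c * b))⁻¹ ^ p.toReal *
        eLpNorm k p (weightedMeasure μ p ω) ^ p.toReal := by
  have hp0 : p ≠ 0 := (zero_lt_one.trans_le hp1.out).ne'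
  rw [hω.eLpNorm_eq hp, ← eLpNorm_comp_mul_left hω s]
  have hmp := measurePreserving_mul_left μ s
  have hm : AEStronglyMeasurable (fun t => ω (s * t) • k (s * t)) μ :=
    ((hω.aemeasurable hp).aestronglyMeasurable.smul hk).comp_measurePreserving hmp
  refine le_trans (measure_mono ?_) (meas_ge_le_mul_pow_eLpNorm_enorm μ hp0 hp hm
    (ENNReal.ofReal_pos.2 (mul_pos hc hb)).ne' (by simp))
  rintro t ⟨htD, htb⟩
  simp only [mem_ofPred_eq, ← ofReal_norm, norm_smul, Real.norm_of_nonneg (hω.1 _).le]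
  refine ENNReal.ofReal_le_ofReal ?_
  rw [mul_comm]
  exact mul_le_mul htb (hD t htD) hc.le (hω.1 _).le

end Weight

/-! ### Translation operators -/

section Translation
variable (hω : IsWeight μ p ω)
include hω

theorem IsWeight.ae_comp_mul_left {P : G → Prop} (s : G)
    (h : ∀ᵐ t ∂weightedMeasure μ p ω, P t) :
    ∀ᵐ t ∂weightedMeasure μ p ω, P (s * t) := by
  rw [hω.ae_eq] at h ⊢
  exact (measurePreserving_mul_left μ s).quasiMeasurePreserving.ae h

theorem IsWeight.aestronglyMeasurable_comp_mul_left {f : G → ℂ} (s : G)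
    (h : AEStronglyMeasurable f (weightedMeasure μ p ω)) :
    AEStronglyMeasurable (fun t => f (s * t)) (weightedMeasure μ p ω) :=
  ((h.mono_ac hω.absolutelyContinuous).comp_measurePreserving
    (measurePreserving_mul_left μ s)).mono_ac (weightedMeasure_absolutelyContinuous hω)

theorem IsWeight.eLpNorm_translate_le_mul (hp : p ≠ ∞) {s : G}
    (hs : translationBound μ ω s < ∞) (f : G → ℂ) :
    eLpNorm (fun t => f (s⁻¹ * t)) p (weightedMeasure μ p ω) ≤
      translationBound μ ω s * eLpNorm f p (weightedMeasure μ p ω) := by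
  rw [hω.eLpNorm_translate_eq hp, hω.eLpNorm_eq hp]
  have h : ∀ᵐ t ∂μ, ‖ω (s * t) • f t‖ ≤ (translationBound μ ω s).toReal * ‖ω t • f t‖ := by
    filter_upwards [ae_le_essSup (μ := μ) (f := fun t => ENNReal.ofReal (ω (s * t) / ω t))]
      with t ht
    have h1 := (ENNReal.ofReal_le_iff_le_toReal hs.ne).1 ht
    rw [div_le_iff₀ (hω.1 t)] at h1
    rw [norm_smul, norm_smul, Real.norm_of_nonneg (hω.1 _).le, Real.norm_of_nonneg (hω.1 _).le,
      ← mul_assoc]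
    exact mul_le_mul_of_nonneg_right h1 (norm_nonneg _)
  refine (eLpNorm_le_mul_eLpNorm_of_ae_le_mul h p).trans_eq ?_
  rw [ENNReal.ofReal_toReal hs.ne]

theorem IsWeight.memLp_translate (hp : p ≠ ∞) {s : G} (hs : translationBound μ ω s < ∞)
    {f : G → ℂ} (hf : MemLp f p (weightedMeasure μ p ω)) :
    MemLp (fun t => f (s⁻¹ * t)) p (weightedMeasure μ p ω) :=
  ⟨hω.aestronglyMeasurable_comp_mul_left _ hf.1,
    (hω.eLpNorm_translate_le_mul hp hs f).trans_lt (ENNReal.mul_lt_top hs hf.2)⟩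

theorem IsWeight.ae_eq_translate {f g : G → ℂ} (s : G)
    (h : f =ᵐ[weightedMeasure μ p ω] g) :
    (fun t => f (s⁻¹ * t)) =ᵐ[weightedMeasure μ p ω] fun t => g (s⁻¹ * t) :=
  hω.ae_comp_mul_left (P := fun t => f t = g t) s⁻¹ h

/-- The translation operator `T_s` on `L^p(G, ω)`. -/
noncomputable def translation (hp : p ≠ ∞) {s : G} (hs : translationBound μ ω s < ∞) :
    WeightedLp μ p ω →L[ℂ] WeightedLp μ p ω :=
  lpComp (fun t => s⁻¹ * t) (fun _ => hω.ae_comp_mul_left s⁻¹)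
    (fun _ => hω.memLp_translate hp hs) (translationBound μ ω s) hs.ne
    (hω.eLpNorm_translate_le_mul hp hs)

theorem coeFn_translation (hp : p ≠ ∞) {s : G} (hs : translationBound μ ω s < ∞)
    (f : WeightedLp μ p ω) :
    translation hω hp hs f =ᵐ[weightedMeasure μ p ω] fun t => f (s⁻¹ * t) :=
  MemLp.coeFn_toLp (hω.memLp_translate hp hs (Lp.memLp f))

theorem translation_toLp (hp : p ≠ ∞) {s : G} (hs : translationBound μ ω s < ∞)
    {f : G → ℂ} (hf : MemLp f p (weightedMeasure μ p ω)) :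
    translation hω hp hs hf.toLp = (hω.memLp_translate hp hs hf).toLp :=
  MemLp.toLp_congr (hω.memLp_translate hp hs (Lp.memLp _)) (hω.memLp_translate hp hs hf)
    (hω.ae_eq_translate s hf.coeFn_toLp)

theorem mem_scaledOrbit_iff (hp : p ≠ ∞) (hadm : IsAdmissible μ S ω) {Γ : Set ℂ}
    {f g : WeightedLp μ p ω} :
    g ∈ scaledOrbit μ p ω Γ S f ↔
      ∃ c ∈ Γ, ∃ s, ∃ hs : s ∈ S, g = c • translation hω hp (hadm s hs) f := by
  have key : ∀ c : ℂ, ∀ s, ∀ hs : s ∈ S, (g =ᵐ[μ] fun t => c * f (s⁻¹ * t)) ↔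
      g = c • translation hω hp (hadm s hs) f := by
    intro c s hs
    have h1 : c • translation hω hp (hadm s hs) f =ᵐ[weightedMeasure μ p ω]
        fun t => c * f (s⁻¹ * t) := by
      filter_upwards [Lp.coeFn_smul c (translation hω hp (hadm s hs) f),
        coeFn_translation hω hp (hadm s hs) f] with t h2 h3
      rw [h2, Pi.smul_apply, h3, smul_eq_mul]
    have h2 : (g =ᵐ[μ] fun t => c * f (s⁻¹ * t)) ↔
        g =ᵐ[weightedMeasure μ p ω] fun t => c * f (s⁻¹ * t) := by
      rw [Filter.EventuallyEq, Filter.EventuallyEq, hω.ae_eq]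
    rw [h2]
    exact ⟨fun h => Lp.ext (EventuallyEq.trans h h1.symm), fun h => h ▸ h1⟩
  constructor
  · rintro ⟨c, hc, s, hs, h⟩
    exact ⟨c, hc, s, hs, (key c s hs).1 h⟩
  · rintro ⟨c, hc, s, hs, h⟩
    exact ⟨c, hc, s, hs, (key c s hs).2 h⟩

end Translation

/-- The weight condition that characterizes the existence of `(Γ, S)`-dense vectors. -/
def ScaledCriterion (μ : Measure G) (ω : G → ℝ) (Γ : Set ℂ) (S : Set G) : Prop :=
  ∀ F : Set G, IsCompact F → ∀ ε : ℝ, 0 < ε → ∃ s ∈ S, ∃ c ∈ Γ, c ≠ 0 ∧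
    ∃ E : Set G, IsCompact E ∧ E ⊆ F ∧ μ (F \ E) < ENNReal.ofReal ε ∧
      essSupTranslate μ ω E s ≤ ENNReal.ofReal (ε / ‖c‖) ∧
      essSupTranslate μ ω E s⁻¹ ≤ ENNReal.ofReal (ε * ‖c‖)

/-! ### The criterion yields a dense vector -/

section Sufficiency
variable [T2Space G] (hω : IsWeight μ p ω)
include hω

theorem IsWeight.exists_continuous_mem (hp : p ≠ ∞) {U : Set (WeightedLp μ p ω)} (hU : IsOpen U)
    (hne : U.Nonempty) :
    ∃ f : G → ℂ, Continuous f ∧ HasCompactSupport f ∧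
      ∃ hf : MemLp f p (weightedMeasure μ p ω), hf.toLp ∈ U := by
  have := hω.isLocallyFiniteMeasure
  obtain ⟨u, hu⟩ := hne
  obtain ⟨r, hr, hball⟩ := EMetric.isOpen_iff.1 hU u hu
  obtain ⟨r', hr', hrr⟩ := exists_between hr
  obtain ⟨f, hfs, hfu, hfc, hf⟩ :=
    (Lp.memLp u).exists_hasCompactSupport_eLpNorm_sub_le hp hr'.ne'
  refine ⟨f, hfc, hfs, hf, hball ?_⟩
  rw [Metric.mem_eball, edist_comm, ← Lp.toLp_coeFn u (Lp.memLp u), Lp.edist_toLp_toLp]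
  exact hfu.trans_lt hrr

/-- The operators `c T_s` that satisfy the criterion form a transitive family. -/
theorem ScaledCriterion.exists_approx (hp : p ≠ ∞) {Γ : Set ℂ} (hcrit : ScaledCriterion μ ω Γ S)
    {f g : G → ℂ} (hfc : Continuous f) (hfs : HasCompactSupport f) (hgc : Continuous g)
    (hgs : HasCompactSupport g) {r : ℝ≥0∞} (hr : 0 < r) :
    ∃ s ∈ S, ∃ c ∈ Γ, ∃ u : G → ℂ, MemLp u p (weightedMeasure μ p ω) ∧
      eLpNorm (fun t => u t - f t) p (weightedMeasure μ p ω) < r ∧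
      eLpNorm (fun t => c * u (s⁻¹ * t) - g t) p (weightedMeasure μ p ω) < r := by
  have hfin := hω.isLocallyFiniteMeasure
  have hp0 : p ≠ 0 := (zero_lt_one.trans_le hp1.out).ne'
  have hpr := toReal_pos_of_one_le hp1.out hp
  set ν := weightedMeasure μ p ω with hν
  obtain ⟨C, hC0, hCf, hCg⟩ : ∃ C : ℝ, 0 < C ∧ (∀ t, ‖f t‖ ≤ C) ∧ ∀ t, ‖g t‖ ≤ C := by
    obtain ⟨C₁, h₁⟩ := hfc.bounded_above_of_compact_support hfs
    obtain ⟨C₂, h₂⟩ := hgc.bounded_above_of_compact_support hgs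
    exact ⟨max (max C₁ C₂) 1, by positivity, fun t => (h₁ t).trans (by simp),
      fun t => (h₂ t).trans (by simp)⟩
  set F := tsupport f ∪ tsupport g with hF
  have hFc : IsCompact F := hfs.isCompact.union hgs.isCompact
  have hfF : ∀ t ∉ F, f t = 0 := fun t ht => image_eq_zero_of_notMem_tsupport fun h => ht (.inl h)
  have hgF : ∀ t ∉ F, g t = 0 := fun t ht => image_eq_zero_of_notMem_tsupport fun h => ht (.inr h)
  have hr2 : 0 < r / 2 := ENNReal.half_pos hr.ne'
  -- smallness of the truncation error
  obtain ⟨δ, hδ, hδν⟩ : ∃ δ > (0 : ℝ≥0∞), ∀ A ⊆ F, μ A < δ →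
      ν A ^ p.toReal⁻¹ * ENNReal.ofReal C < r / 2 := by
    have hC' : ENNReal.ofReal C ≠ 0 := (ENNReal.ofReal_pos.2 hC0).ne'
    have hq : 0 < r / 2 / ENNReal.ofReal C := ENNReal.div_pos hr2.ne' ENNReal.ofReal_ne_top
    obtain ⟨δ, hδ, H⟩ := hω.exists_forall_weightedMeasure_lt hFc
      (ε := (r / 2 / ENNReal.ofReal C) ^ p.toReal)
      (ENNReal.rpow_pos_of_nonneg hq hpr.le).ne'
    refine ⟨δ, hδ, fun A hA hAδ => ?_⟩
    rw [← ENNReal.lt_div_iff_mul_lt (.inl hC') (.inl ENNReal.ofReal_ne_top)]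
    exact (ENNReal.rpow_inv_lt_iff hpr).2 (H A hA hAδ)
  -- smallness of the translated parts
  obtain ⟨ε, hε, hεδ, hεr⟩ : ∃ ε : ℝ, 0 < ε ∧ ENNReal.ofReal ε < δ ∧
      μ F ^ p.toReal⁻¹ * ENNReal.ofReal (ε * C) < r / 2 := by
    have hm : μ F ^ p.toReal⁻¹ ≠ ∞ :=
      ENNReal.rpow_ne_top_of_nonneg (by positivity) hFc.measure_lt_top.ne
    have h0 : Tendsto (fun ε : ℝ => ENNReal.ofReal ε) (𝓝[>] 0) (𝓝 0) := by
      have := (ENNReal.continuous_ofReal.tendsto 0).mono_left (nhdsWithin_le_nhds (s := Ioi 0))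
      simpa using this
    have h1 : Tendsto (fun ε : ℝ => μ F ^ p.toReal⁻¹ * ENNReal.ofReal (ε * C)) (𝓝[>] 0)
        (𝓝 0) := by
      have h2 : Tendsto (fun ε : ℝ => ENNReal.ofReal (ε * C)) (𝓝[>] 0) (𝓝 0) := by
        have := ((ENNReal.continuous_ofReal.comp (continuous_mul_const C)).tendsto 0).mono_left
          (nhdsWithin_le_nhds (s := Ioi 0))
        simpa [Function.comp_def] using this
      simpa using ENNReal.Tendsto.const_mul h2 (.inr hm)
    obtain ⟨ε, ⟨h3, h4⟩, h5⟩ := ((h0.eventually_lt_const hδ).and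
      (h1.eventually_lt_const hr2)).and self_mem_nhdsWithin |>.exists
    exact ⟨ε, h5, h3, h4⟩
  obtain ⟨s, hs, c, hc, hc0, E, hE, hEF, hμE, hs1, hs2⟩ := hcrit F hFc ε hε
  have hcn : 0 < ‖c‖ := norm_pos_iff.2 hc0
  have hμE' : μ (F \ E) < δ := hμE.trans hεδ
  have hEm := hE.measurableSet
  have hind : ∀ k : G → ℂ, (∀ t, ‖k t‖ ≤ C) → ∀ t, ‖E.indicator k t‖ ≤ C := fun k hk t =>
    (norm_indicator_le_norm_self k t).trans (hk t)
  have hmeas : ∀ k : G → ℂ, Continuous k → AEStronglyMeasurable (E.indicator k) ν :=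
    fun k hk => hk.aestronglyMeasurable.indicator hEm
  have hrest : ∀ k : G → ℂ, Continuous k → (∀ t, ‖k t‖ ≤ C) →
      eLpNorm ((F \ E).indicator k) p ν < r / 2 := by
    intro k hk hkC
    rw [eLpNorm_indicator_eq_eLpNorm_restrict (hFc.measurableSet.diff hEm)]
    refine (eLpNorm_le_of_ae_bound (.of_forall hkC)).trans_lt ?_
    simpa using hδν _ sdiff_subset hμE'
  have hμEF : μ E ^ p.toReal⁻¹ ≤ μ F ^ p.toReal⁻¹ :=
    ENNReal.rpow_le_rpow (measure_mono hEF) (by positivity)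
  have hfT := hω.eLpNorm_translate_le hp (hind f hCf) (by positivity) (fun t ht => by simp [ht]) hs1
  have hgT := hω.eLpNorm_translate_le hp (hind g hCg) (by positivity) (fun t ht => by simp [ht]) hs2
  rw [inv_inv] at hgT
  have hgM : MemLp (fun t => E.indicator g (s * t)) p ν :=
    ⟨hω.aestronglyMeasurable_comp_mul_left s (hmeas g hgc), hgT.trans_lt
      (ENNReal.mul_lt_top (ENNReal.rpow_lt_top_of_nonneg (by positivity) hE.measure_lt_top.ne)
        ENNReal.ofReal_lt_top)⟩
  have hfM : MemLp (E.indicator f) p ν := (hfc.memLp_of_hasCompactSupport hfs).indicator hEm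
  -- Membership of u in L^p comes from the bound on ω(s⁻¹·) over E; translation by s⁻¹ need not be
  -- bounded on the whole space.
  refine ⟨s, hs, c, hc, fun t => E.indicator f t + c⁻¹ • E.indicator g (s * t),
    hfM.add (hgM.const_smul c⁻¹), ?_, ?_⟩
  · have h1 : (fun t => E.indicator f t + c⁻¹ • E.indicator g (s * t) - f t) =
        c⁻¹ • (fun t => E.indicator g (s * t)) - (F \ E).indicator f := by
      ext t
      by_cases h1 : t ∈ E
      · simp [h1]
      · by_cases h2 : t ∈ F
        · simp [h1, h2]
        · simp [h1, h2, hfF t h2]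
    rw [h1]
    refine (eLpNorm_sub_le (hgM.1.const_smul _)
      (hfc.aestronglyMeasurable.indicator (hFc.measurableSet.diff hEm)) hp1.out).trans_lt ?_
    rw [← ENNReal.add_halves r]
    refine ENNReal.add_lt_add (lt_of_le_of_lt ?_ hεr) (hrest f hfc hCf)
    rw [eLpNorm_const_smul]
    calc ‖c⁻¹‖ₑ * eLpNorm (fun t => E.indicator g (s * t)) p ν
        ≤ ENNReal.ofReal (‖c‖⁻¹) * (μ F ^ p.toReal⁻¹ * ENNReal.ofReal (ε * ‖c‖ * C)) := by
          rw [← ofReal_norm, norm_inv]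
          gcongr
          exact hgT.trans (by gcongr)
      _ = μ F ^ p.toReal⁻¹ * ENNReal.ofReal (ε * C) := by
          rw [mul_left_comm, ← ENNReal.ofReal_mul (by positivity)]
          congr 2
          field_simp
  · have h1 : (fun t => c * (E.indicator f (s⁻¹ * t) + c⁻¹ • E.indicator g (s * (s⁻¹ * t))) - g t) =
        c • (fun t => E.indicator f (s⁻¹ * t)) - (F \ E).indicator g := by
      ext t
      rw [mul_inv_cancel_left, mul_add, smul_eq_mul, mul_inv_cancel_left₀ hc0]
      by_cases h1 : t ∈ E
      · simp [h1]
      · by_cases h2 : t ∈ F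
        · simp [h1, h2]
        · simp [h1, h2, hgF t h2]
    rw [h1]
    refine (eLpNorm_sub_le ((hω.aestronglyMeasurable_comp_mul_left _ (hmeas f hfc)).const_smul _)
      (hgc.aestronglyMeasurable.indicator (hFc.measurableSet.diff hEm)) hp1.out).trans_lt ?_
    rw [← ENNReal.add_halves r]
    refine ENNReal.add_lt_add (lt_of_le_of_lt ?_ hεr) (hrest g hgc hCg)
    rw [eLpNorm_const_smul]
    calc ‖c‖ₑ * eLpNorm (fun t => E.indicator f (s⁻¹ * t)) p ν
        ≤ ENNReal.ofReal ‖c‖ * (μ F ^ p.toReal⁻¹ * ENNReal.ofReal (ε / ‖c‖ * C)) := by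
          rw [← ofReal_norm]
          gcongr
          exact hfT.trans (by gcongr)
      _ = μ F ^ p.toReal⁻¹ * ENNReal.ofReal (ε * C) := by
          rw [mul_left_comm, ← ENNReal.ofReal_mul (by positivity)]
          congr 2
          field_simp

theorem ScaledCriterion.hasScaledDenseVector (hp : p ≠ ∞) (hadm : IsAdmissible μ S ω) {Γ : Set ℂ}
    (hcrit : ScaledCriterion μ ω Γ S) : HasScaledDenseVector μ p ω Γ S := by
  have hfin := hω.isLocallyFiniteMeasure
  have : Fact (p ≠ ∞) := ⟨hp⟩
  obtain ⟨f, hf⟩ := exists_dense_range_of_transitive (X := WeightedLp μ p ω)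
    (fun i : Γ × S => fun f => (i.1 : ℂ) • translation hω hp (hadm i.2 i.2.2) f)
    (fun i => (translation hω hp (hadm i.2 i.2.2)).continuous.const_smul (i.1 : ℂ)) (by
      intro U V hU hV hUne hVne
      obtain ⟨f, hfc, hfs, hf, hfU⟩ := hω.exists_continuous_mem hp hU hUne
      obtain ⟨g, hgc, hgs, hg, hgV⟩ := hω.exists_continuous_mem hp hV hVne
      obtain ⟨r₁, hr₁, hb₁⟩ := EMetric.isOpen_iff.1 hU _ hfU
      obtain ⟨r₂, hr₂, hb₂⟩ := EMetric.isOpen_iff.1 hV _ hgV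
      obtain ⟨s, hs, c, hc, u, hu, h1, h2⟩ := hcrit.exists_approx hω hp hfc hfs hgc hgs
        (lt_min hr₁ hr₂)
      refine ⟨(⟨c, hc⟩, ⟨s, hs⟩), hu.toLp, hb₁ ?_, hb₂ ?_⟩
      · rw [Metric.mem_eball, Lp.edist_toLp_toLp]
        exact h1.trans_le (min_le_left _ _)
      · rw [Metric.mem_eball, translation_toLp hω, ← MemLp.toLp_const_smul, Lp.edist_toLp_toLp]
        exact h2.trans_le (min_le_right _ _))
  refine ⟨f, hf.mono ?_⟩
  rintro _ ⟨⟨c, s⟩, rfl⟩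
  exact (mem_scaledOrbit_iff hω hp hadm).2 ⟨c, c.2, s, s.2, rfl⟩

end Sufficiency

/-! ### A dense vector yields the criterion -/

section Necessity
variable [T2Space G] (hω : IsWeight μ p ω)
include hω

/-- Although s⁻¹ need not be admissible, each g in C_c is the image of c⁻¹ g(s·), which is again in
C_c. -/
theorem denseRange_smul_translation (hp : p ≠ ∞) {s : G} (hs : translationBound μ ω s < ∞)
    {c : ℂ} (hc : c ≠ 0) : DenseRange fun f => c • translation hω hp hs f := by
  have hfin := hω.isLocallyFiniteMeasure
  refine dense_iff_inter_open.2 fun U hU hne => ?_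
  obtain ⟨g, hgc, hgs, hg, hgU⟩ := hω.exists_continuous_mem hp hU hne
  have hg' : MemLp (fun t => g (s * t)) p (weightedMeasure μ p ω) :=
    (hgc.comp (continuous_const_mul s)).memLp_of_hasCompactSupport
      (hgs.comp_homeomorph (Homeomorph.mulLeft s))
  refine ⟨_, hgU, c⁻¹ • hg'.toLp, ?_⟩
  simp only [map_smul]
  rw [smul_inv_smul₀ hc, translation_toLp hω]
  exact MemLp.toLp_congr _ _ (.of_forall fun t => by simp)

theorem translation_comm (hp : p ≠ ∞) {s s' : G} (hs : translationBound μ ω s < ∞)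
    (hs' : translationBound μ ω s' < ∞) (hcomm : s * s' = s' * s) (f : WeightedLp μ p ω) :
    translation hω hp hs (translation hω hp hs' f) =
      translation hω hp hs' (translation hω hp hs f) := by
  apply Lp.ext
  filter_upwards [coeFn_translation hω hp hs (translation hω hp hs' f),
    coeFn_translation hω hp hs' (translation hω hp hs f),
    hω.ae_eq_translate s (coeFn_translation hω hp hs' f),
    hω.ae_eq_translate s' (coeFn_translation hω hp hs f)] with t h1 h2 h3 h4
  rw [h1, h2, h3, h4, ← mul_assoc, ← mul_assoc, ← mul_inv_rev, ← mul_inv_rev, hcomm]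

/-- If the translations commute, then the nonzero vectors of a dense orbit have dense orbits. -/
theorem dense_scaledOrbit_smul_translation (hp : p ≠ ∞) (hadm : IsAdmissible μ S ω)
    (hcomm : ∀ x ∈ S, ∀ y ∈ S, x * y = y * x) {Γ : Set ℂ} {f : WeightedLp μ p ω}
    (hf : Dense (scaledOrbit μ p ω Γ S f)) {s : G} (hs : s ∈ S) {c : ℂ} (hc : c ≠ 0) :
    Dense (scaledOrbit μ p ω Γ S (c • translation hω hp (hadm s hs) f)) := by
  refine ((denseRange_smul_translation hω hp (hadm s hs) hc).dense_image
    ((translation hω hp (hadm s hs)).continuous.const_smul c) hf).mono ?_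
  rintro _ ⟨g, hg, rfl⟩
  obtain ⟨c', hc', s', hs', rfl⟩ := (mem_scaledOrbit_iff hω hp hadm).1 hg
  refine (mem_scaledOrbit_iff hω hp hadm).2 ⟨c', hc', s', hs', ?_⟩
  simp only [map_smul]
  rw [smul_comm, translation_comm hω hp (hadm s hs) (hadm s' hs') (hcomm s hs s' hs')]

theorem IsWeight.memLp_indicator_const {F : Set G} (hF : IsCompact F) (c : ℂ) :
    MemLp (F.indicator fun _ => c) p (weightedMeasure μ p ω) :=
  MeasureTheory.memLp_indicator_const p hF.measurableSet c (.inr (hω.weightedMeasure_lt_top hF).ne)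

theorem IsWeight.nontrivial_weightedLp (hp : p ≠ ∞) : Nontrivial (WeightedLp μ p ω) := by
  obtain ⟨K, hK, hK1⟩ := exists_compact_mem_nhds (1 : G)
  have hμK : μ K ≠ 0 := (Measure.measure_pos_of_mem_nhds μ hK1).ne'
  have hνK : weightedMeasure μ p ω K ≠ 0 := fun h => hμK (hω.absolutelyContinuous h)
  refine ⟨⟨(hω.memLp_indicator_const hK 1).toLp, 0, fun h => ?_⟩⟩
  have h1 := congrArg (fun x : WeightedLp μ p ω => ‖x‖ₑ) h
  simp only [enorm_zero, Lp.enorm_toLp] at h1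
  rw [eLpNorm_indicator_const hK.measurableSet (zero_lt_one.trans_le hp1.out).ne' hp] at h1
  simp [ENNReal.rpow_eq_zero_iff, hνK, (hω.weightedMeasure_lt_top hK).ne] at h1

/-- The scalar `0` is not needed for the density of an orbit. -/
theorem dense_scaledOrbit_diff_zero (hp : p ≠ ∞) (hadm : IsAdmissible μ S ω) {Γ : Set ℂ}
    {f : WeightedLp μ p ω} (hf : Dense (scaledOrbit μ p ω Γ S f)) :
    Dense (scaledOrbit μ p ω (Γ \ {0}) S f) := by
  have := hω.nontrivial_weightedLp hp
  have : (𝓝[≠] (0 : WeightedLp μ p ω)).NeBot := Module.punctured_nhds_neBot ℂ _ 0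
  -- The scalar 0 contributes only the origin, which is not isolated and can be removed from a dense
  -- set.
  refine (hf.sdiff_singleton 0).mono ?_
  rintro g ⟨hg, hg0⟩
  obtain ⟨c, hc, s, hs, rfl⟩ := (mem_scaledOrbit_iff hω hp hadm).1 hg
  refine (mem_scaledOrbit_iff hω hp hadm).2 ⟨c, ⟨hc, ?_⟩, s, hs, rfl⟩
  rintro rfl
  exact hg0 (by simp)

/-- From a dense orbit, one obtains a function that approximates two prescribed functions, one of
them after a scaled translation. -/
theorem exists_approx_of_dense (hp : p ≠ ∞) (hadm : IsAdmissible μ S ω)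
    (hcomm : ∀ x ∈ S, ∀ y ∈ S, x * y = y * x) {Γ : Set ℂ} (hΓ : HasScaledDenseVector μ p ω Γ S)
    {f g : G → ℂ} (hf : MemLp f p (weightedMeasure μ p ω))
    (hg : MemLp g p (weightedMeasure μ p ω)) {δ : ℝ≥0∞} (hδ : 0 < δ) :
    ∃ h : G → ℂ, AEStronglyMeasurable h μ ∧ ∃ s ∈ S, ∃ c ∈ Γ, c ≠ 0 ∧
      eLpNorm (fun t => h t - f t) p (weightedMeasure μ p ω) < δ ∧
      eLpNorm (fun t => c * h (s⁻¹ * t) - g t) p (weightedMeasure μ p ω) < δ := by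
  obtain ⟨u, hu⟩ := hΓ
  replace hu := dense_scaledOrbit_diff_zero hω hp hadm hu
  obtain ⟨v, hv, hvf⟩ := EMetric.mem_closure_iff.1 (hu hf.toLp) δ hδ
  obtain ⟨c₁, hc₁, s₁, hs₁, rfl⟩ := (mem_scaledOrbit_iff hω hp hadm).1 hv
  have hd := dense_scaledOrbit_smul_translation hω hp hadm hcomm hu hs₁ hc₁.2
  set h := c₁ • translation hω hp (hadm s₁ hs₁) u
  obtain ⟨w, ⟨c, hc, s, hs, hw⟩, hwg⟩ := EMetric.mem_closure_iff.1 (hd hg.toLp) δ hδ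
  refine ⟨h, (Lp.aestronglyMeasurable h).mono_ac hω.absolutelyContinuous, s, hs, c, hc.1, hc.2,
    ?_, ?_⟩
  · rw [edist_comm, Lp.edist_def] at hvf
    refine lt_of_eq_of_lt (eLpNorm_congr_ae ?_) hvf
    filter_upwards [hf.coeFn_toLp] with t ht
    rw [Pi.sub_apply, ht]
  · rw [edist_comm, Lp.edist_def] at hwg
    refine lt_of_eq_of_lt (eLpNorm_congr_ae ?_) hwg
    have hw' : w =ᵐ[weightedMeasure μ p ω] fun t => c * h (s⁻¹ * t) :=
      (weightedMeasure_absolutelyContinuous hω).ae_le hw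
    filter_upwards [hg.coeFn_toLp, hw'] with t ht hwt
    rw [Pi.sub_apply, ht, hwt]

/-- By left invariance the preimage of C under translation by s has measure μ C, so B and this
preimage cannot cover A. -/
theorem exists_notMem_of_measure_lt {A B C : Set G} (h : μ B + μ C < μ A) (s : G) :
    ∃ t ∈ A, t ∉ B ∧ s * t ∉ C := by
  by_contra! H
  refine absurd h (not_lt.2 ?_)
  calc μ A ≤ μ (B ∪ (fun t => s * t) ⁻¹' C) := measure_mono fun t ht => by
        by_cases hB : t ∈ B
        · exact .inl hB
        · exact .inr (H t ht hB)
    _ ≤ μ B + μ C := (measure_union_le _ _).trans_eq (by rw [measure_preimage_mul])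

/-- In a non-compact group, the translation in `exists_approx_of_dense` can be chosen to move a
given compact set almost off itself. -/
theorem exists_approx_indicator_of_dense [NoncompactSpace G] (hp : p ≠ ∞)
    (hadm : IsAdmissible μ S ω)
    (hcomm : ∀ x ∈ S, ∀ y ∈ S, x * y = y * x) {Γ : Set ℂ} (hΓ : HasScaledDenseVector μ p ω Γ S)
    {F : Set G} (hF : IsCompact F) {δ : ℝ≥0∞} (hδ : 0 < δ) {η : ℝ} (hη : 0 < η) :
    ∃ h : G → ℂ, AEStronglyMeasurable h μ ∧ ∃ s ∈ S, ∃ c ∈ Γ, c ≠ 0 ∧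
      eLpNorm (fun t => h t - F.indicator (fun _ => 1) t) p (weightedMeasure μ p ω) < δ ∧
      eLpNorm (fun t => c * h (s⁻¹ * t) - F.indicator (fun _ => 1) t) p (weightedMeasure μ p ω) <
        δ ∧
      μ {t ∈ F | s⁻¹ * t ∈ F} ≤ ENNReal.ofReal η := by
  have hp0 : p ≠ 0 := (zero_lt_one.trans_le hp1.out).ne'
  -- K contains every s for which sF meets F.
  set K := F * F⁻¹ with hK
  have hKc : IsCompact K := hF.mul hF.inv
  have hKF : IsCompact (F ∪ K * F) := hF.union (hKc.mul hF)
  -- a compact set away from the translates of `F` that meet `F`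
  obtain ⟨H, hH, hHdisj, hμH⟩ : ∃ H : Set G, IsCompact H ∧ Disjoint H (F ∪ K * F) ∧ 0 < μ H := by
    obtain ⟨x, hx⟩ := (ne_univ_iff_exists_notMem _).1 hKF.ne_univ
    obtain ⟨H, hH, hxH, hHsub⟩ := exists_compact_subset hKF.isClosed.isOpen_compl hx
    exact ⟨H, hH, disjoint_left.2 fun t ht => hHsub ht,
      Measure.measure_pos_of_mem_nhds μ (mem_interior_iff_mem_nhds.1 hxH)⟩
  have hHF : ∀ t ∈ H, t ∉ F := fun t ht h => disjoint_left.1 hHdisj ht (.inl h)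
  obtain ⟨κ, hκ0, hκ1, hκδ⟩ : ∃ κ : ℝ, 0 < κ ∧ κ ≤ 1 ∧
      eLpNorm (H.indicator fun _ => (κ : ℂ)) p (weightedMeasure μ p ω) < δ / 2 := by
    have hm : weightedMeasure μ p ω H ^ (1 / p.toReal) ≠ ∞ :=
      ENNReal.rpow_ne_top_of_nonneg (by positivity) (hω.weightedMeasure_lt_top hH).ne
    have h0 : Tendsto (fun κ : ℝ => ‖(κ : ℂ)‖ₑ) (𝓝[>] 0) (𝓝 0) := by
      have := ((continuous_enorm.comp Complex.continuous_ofReal).tendsto 0).mono_left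
        (nhdsWithin_le_nhds (s := Ioi 0))
      simpa [Function.comp_def] using this
    have h1 := ENNReal.Tendsto.mul_const h0 (.inr hm)
    rw [zero_mul] at h1
    obtain ⟨κ, ⟨h2, h3⟩, h4⟩ := ((h1.eventually_lt_const (ENNReal.half_pos hδ.ne')).and
      (nhdsWithin_le_nhds (Iic_mem_nhds (zero_lt_one' ℝ)))).and self_mem_nhdsWithin |>.exists
    refine ⟨κ, h4, h3, ?_⟩
    rwa [eLpNorm_indicator_const hH.measurableSet hp0 hp]
  obtain ⟨η', hη', hη'η, hη'H⟩ : ∃ η' : ℝ, 0 < η' ∧ η' + η' ≤ η ∧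
      ENNReal.ofReal η' + ENNReal.ofReal η' ≤ μ H := by
    have hpos : 0 < (μ H).toReal := ENNReal.toReal_pos hμH.ne' hH.measure_lt_top.ne
    refine ⟨min (η / 2) ((μ H).toReal / 2), by positivity, ?_, ?_⟩
    · linarith [min_le_left (η / 2) ((μ H).toReal / 2)]
    · rw [← ENNReal.ofReal_add (by positivity) (by positivity)]
      refine ENNReal.ofReal_le_of_le_toReal ?_
      linarith [min_le_right (η / 2) ((μ H).toReal / 2)]
  -- The set K⁻¹H is included because h must also be controlled at s⁻¹t' for t' ∈ H and s ∈ K.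
  obtain ⟨δ₁, hδ₁, hP⟩ := hω.exists_forall_measure_enorm_ge_lt hp
    (hF.union (hKc.inv.mul hH)) (r := κ / 8) (by positivity) hη'
  obtain ⟨δ₂, hδ₂, hQ⟩ := hω.exists_forall_measure_enorm_ge_lt hp (hF.union hH)
    (r := κ / 8) (by positivity) hη'
  have hχF := hω.memLp_indicator_const hF 1
  have hχH := hω.memLp_indicator_const hH κ
  obtain ⟨h, hh, s, hs, c, hc, hc0, h1, h2⟩ := exists_approx_of_dense hω hp hadm hcomm hΓ hχF
    (hχF.add hχH) (lt_min (ENNReal.half_pos hδ.ne') (lt_min hδ₁ hδ₂))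
  have hhs : AEStronglyMeasurable (fun t => h (s⁻¹ * t)) μ :=
    hh.comp_measurePreserving (measurePreserving_mul_left μ s⁻¹)
  have hk₁ : AEStronglyMeasurable (fun t => h t - F.indicator (fun _ => 1) t) μ :=
    hh.sub (aestronglyMeasurable_const.indicator hF.measurableSet)
  have hk₂ : AEStronglyMeasurable (fun t => c * h (s⁻¹ * t) -
      (F.indicator (fun _ => (1 : ℂ)) + H.indicator (fun _ => (κ : ℂ)) : G → ℂ) t) μ :=
    (hhs.const_mul c).sub ((aestronglyMeasurable_const.indicator hF.measurableSet).add
      (aestronglyMeasurable_const.indicator hH.measurableSet))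
  refine ⟨h, hh, s, hs, c, hc, hc0,
    h1.trans_le ((min_le_left _ _).trans ENNReal.half_le_self), ?_, ?_⟩
  · have heq : (fun t => c * h (s⁻¹ * t) - F.indicator (fun _ => (1 : ℂ)) t) =
        (fun t => c * h (s⁻¹ * t) -
          (F.indicator (fun _ => (1 : ℂ)) + H.indicator (fun _ => (κ : ℂ)) : G → ℂ) t) +
        H.indicator fun _ => (κ : ℂ) := by
      ext t
      simp only [Pi.add_apply]
      ring
    rw [heq, ← ENNReal.add_halves δ]
    exact (eLpNorm_add_le (hk₂.mono_ac (weightedMeasure_absolutelyContinuous hω)) hχH.1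
      hp1.out).trans_lt (ENNReal.add_lt_add (h2.trans_le (min_le_left _ _)) hκδ)
  · by_contra! hA
    have hP' := hP _ hk₁ (h1.trans_le ((min_le_right _ _).trans (min_le_left _ _)))
    have hQ' := hQ _ hk₂ (h2.trans_le ((min_le_right _ _).trans (min_le_right _ _)))
    have hsum := ENNReal.add_lt_add hQ' hP'
    -- a point of `F` whose translate is in `F` bounds the scalar from above
    obtain ⟨t, ⟨htF, hstF⟩, htQ, htP⟩ := exists_notMem_of_measure_lt hω
      (hsum.trans ((by rw [← ENNReal.ofReal_add hη'.le hη'.le]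
                       exact ENNReal.ofReal_le_ofReal hη'η : _ ≤ ENNReal.ofReal η).trans_lt hA)) s⁻¹
    have htH : t ∉ H := fun h => hHF t h htF
    simp only [mem_inter_iff, mem_union, htF, hstF, htH, mem_ofPred_eq, true_or, true_and, not_le,
      indicator_of_mem, indicator_of_notMem, Pi.add_apply, add_zero, not_false_eq_true] at htP htQ
    have hsK : s ∈ K := ⟨t, htF, (s⁻¹ * t)⁻¹, inv_mem_inv.2 hstF, by simp⟩
    -- a point of `H` bounds the scalar from below
    obtain ⟨t', ht'H, ht'Q, ht'P⟩ := exists_notMem_of_measure_lt hω (hsum.trans_le hη'H) s⁻¹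
    have ht'F := hHF t' ht'H
    have hst'F : s⁻¹ * t' ∉ F := fun h => disjoint_left.1 hHdisj ht'H
      (.inr ⟨s, hsK, s⁻¹ * t', h, by simp⟩)
    have hst'K : s⁻¹ * t' ∈ K⁻¹ * H := ⟨s⁻¹, inv_mem_inv.2 hsK, t', ht'H, rfl⟩
    simp only [mem_inter_iff, mem_union, ht'F, hst'F, ht'H, hst'K, mem_ofPred_eq, or_true,
      true_and, not_le, indicator_of_mem, indicator_of_notMem, Pi.add_apply, zero_add, sub_zero,
      not_false_eq_true] at ht'P ht'Q
    have e1 : 1 - ‖h (s⁻¹ * t)‖ ≤ ‖h (s⁻¹ * t) - 1‖ := by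
      simpa [norm_sub_rev] using norm_sub_norm_le (1 : ℂ) (h (s⁻¹ * t))
    have e2 : ‖c‖ * ‖h (s⁻¹ * t)‖ - 1 ≤ ‖c * h (s⁻¹ * t) - 1‖ := by
      simpa using norm_sub_norm_le (c * h (s⁻¹ * t)) 1
    have e3 : κ - ‖c‖ * ‖h (s⁻¹ * t')‖ ≤ ‖c * h (s⁻¹ * t') - κ‖ := by
      simpa [norm_sub_rev, abs_of_pos hκ0] using norm_sub_norm_le (κ : ℂ) (c * h (s⁻¹ * t'))
    have hcn := norm_pos_iff.2 hc0
    -- On F ∩ sF both h(s⁻¹t) and c h(s⁻¹t) are within κ/8 ≤ 1/8 of 1, so |c| ≤ 9/7 < 2. At t' ∈ H,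
    -- |h(s⁻¹t')| < κ/8 while c h(s⁻¹t') is within κ/8 of κ, which would require |c| > 7.
    have e4 : ‖c‖ * (7 / 8) ≤ ‖c‖ * ‖h (s⁻¹ * t)‖ := by gcongr; linarith
    have e5 : ‖c‖ * ‖h (s⁻¹ * t')‖ ≤ 2 * (κ / 8) := by
      gcongr
      linarith
    linarith

/-- The criterion is necessary when the translations by `S` commute. -/
theorem HasScaledDenseVector.scaledCriterion [NoncompactSpace G] (hp : p ≠ ∞)
    (hadm : IsAdmissible μ S ω)
    (hcomm : ∀ x ∈ S, ∀ y ∈ S, x * y = y * x) {Γ : Set ℂ}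
    (hΓ : HasScaledDenseVector μ p ω Γ S) : ScaledCriterion μ ω Γ S := by
  intro F hF ε hε
  have hpr := toReal_pos_of_one_le hp1.out hp
  have hε8 : 0 < ε / 8 := by positivity
  obtain ⟨δ₁, hδ₁, hB⟩ := hω.exists_forall_measure_enorm_ge_lt hp hF (r := 1 / 2)
    (by positivity) hε8
  have hε2 : ENNReal.ofReal (ε / 2) ≠ 0 := (ENNReal.ofReal_pos.2 (by positivity)).ne'
  -- Both later uses of `measure_translate_ge_le` have c·b = ε/2, since |c| cancels; δ₂ turns that
  -- Chebyshev bound into ε/8.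
  set δ₂ : ℝ≥0∞ := ENNReal.ofReal (ε / 2) * ENNReal.ofReal (ε / 8) ^ p.toReal⁻¹ with hδ₂
  have hδ₂0 : 0 < δ₂ := ENNReal.mul_pos hε2
    (ENNReal.rpow_pos (ENNReal.ofReal_pos.2 hε8) ENNReal.ofReal_ne_top).ne'
  have hδ₂le : ∀ x < δ₂, (ENNReal.ofReal (ε / 2))⁻¹ ^ p.toReal * x ^ p.toReal ≤
      ENNReal.ofReal (ε / 8) := by
    intro x hx
    rw [← ENNReal.mul_rpow_of_nonneg _ _ hpr.le]
    calc ((ENNReal.ofReal (ε / 2))⁻¹ * x) ^ p.toReal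
        ≤ ((ENNReal.ofReal (ε / 2))⁻¹ * δ₂) ^ p.toReal := by gcongr
      _ = ENNReal.ofReal (ε / 8) := by
        rw [hδ₂, ← mul_assoc, ENNReal.inv_mul_cancel hε2 ENNReal.ofReal_ne_top, one_mul,
          ENNReal.rpow_inv_rpow hpr.ne']
  obtain ⟨h, hh, s, hs, c, hc, hc0, h1, h2, hA⟩ := exists_approx_indicator_of_dense hω hp hadm
    hcomm hΓ hF (lt_min hδ₁ hδ₂0) hε8
  have hcn := norm_pos_iff.2 hc0
  set k₁ : G → ℂ := fun t => h t - F.indicator (fun _ => 1) t with hk₁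
  set k₂ : G → ℂ := fun t => c * h (s⁻¹ * t) - F.indicator (fun _ => 1) t with hk₂
  have hhs : AEStronglyMeasurable (fun t => h (s⁻¹ * t)) μ :=
    hh.comp_measurePreserving (measurePreserving_mul_left μ s⁻¹)
  have hk₁m : AEStronglyMeasurable k₁ μ :=
    hh.sub (aestronglyMeasurable_const.indicator hF.measurableSet)
  have hk₂m : AEStronglyMeasurable k₂ μ :=
    (hhs.const_mul c).sub (aestronglyMeasurable_const.indicator hF.measurableSet)
  set A := {t ∈ F | s⁻¹ * t ∈ F} with hAdef
  set A' := {t ∈ F | s * t ∈ F} with hA'def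
  have hA' : μ A' ≤ ENNReal.ofReal (ε / 8) := by
    rw [← measure_preimage_mul μ s] at hA
    refine le_trans (measure_mono ?_) hA
    rintro t ⟨ht, hst⟩
    exact ⟨hst, by simpa using ht⟩
  set B₁ := F ∩ {t | 1 / 2 ≤ ‖k₁ t‖} with hB₁def
  set B₂ := F ∩ {t | 1 / 2 ≤ ‖k₂ t‖} with hB₂def
  have hB₁ : μ B₁ ≤ ENNReal.ofReal (ε / 8) := (hB k₁ hk₁m (h1.trans_le (min_le_left _ _))).le
  have hB₂ : μ B₂ ≤ ENNReal.ofReal (ε / 8) := (hB k₂ hk₂m (h2.trans_le (min_le_left _ _))).le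
  set C₁ := {t ∈ F \ (A' ∪ B₁) | ε / ‖c‖ ≤ ω (s * t)} with hC₁def
  set C₂ := {t ∈ F \ (A ∪ B₂) | ε * ‖c‖ ≤ ω (s⁻¹ * t)} with hC₂def
  -- Off A' ∪ B₁ the point st lies outside F, so k₂(st) = c h(t) with |h(t)| ≥ 1/2.
  have hC₁ : μ C₁ ≤ ENNReal.ofReal (ε / 8) := by
    refine (hω.measure_translate_ge_le hp hk₂m (c := ‖c‖ / 2) (by positivity) (by positivity)
      ?_).trans (le_of_eq_of_le ?_ (hδ₂le _ (h2.trans_le (min_le_right _ _))))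
    · rintro t ⟨htF, ht⟩
      have hst : s * t ∉ F := fun h => ht (.inl ⟨htF, h⟩)
      have hb : ‖h t - 1‖ < 1 / 2 := by
        by_contra! hb
        exact ht (.inr ⟨htF, by simpa [hk₁, htF] using hb⟩)
      have e1 : 1 - ‖h t‖ ≤ ‖h t - 1‖ := by
        simpa [norm_sub_rev] using norm_sub_norm_le (1 : ℂ) (h t)
      have : ‖k₂ (s * t)‖ = ‖c‖ * ‖h t‖ := by simp [hk₂, hst]
      rw [this, div_eq_mul_inv]
      gcongr
      linarith
    · congr 4
      field_simp
  -- Off A ∪ B₂ the point s⁻¹t lies outside F, so k₁(s⁻¹t) = h(s⁻¹t), of modulus at least 1/(2|c|).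
  have hC₂ : μ C₂ ≤ ENNReal.ofReal (ε / 8) := by
    refine (hω.measure_translate_ge_le hp hk₁m (c := 1 / (2 * ‖c‖)) (by positivity)
      (by positivity) ?_).trans (le_of_eq_of_le ?_ (hδ₂le _ (h1.trans_le (min_le_right _ _))))
    · rintro t ⟨htF, ht⟩
      have hst : s⁻¹ * t ∉ F := fun h => ht (.inl ⟨htF, h⟩)
      have hb : ‖c * h (s⁻¹ * t) - 1‖ < 1 / 2 := by
        by_contra! hb
        exact ht (.inr ⟨htF, by simpa [hk₂, htF] using hb⟩)
      have e1 : 1 - ‖c‖ * ‖h (s⁻¹ * t)‖ ≤ ‖c * h (s⁻¹ * t) - 1‖ := by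
        simpa [norm_sub_rev] using norm_sub_norm_le (1 : ℂ) (c * h (s⁻¹ * t))
      have : ‖k₁ (s⁻¹ * t)‖ = ‖h (s⁻¹ * t)‖ := by simp [hk₁, hst]
      rw [this, div_le_iff₀ (by positivity)]
      linarith
    · congr 4
      field_simp
  set B := A ∪ A' ∪ (B₁ ∪ B₂) ∪ (C₁ ∪ C₂) with hBdef
  have hμB : μ B ≤ ENNReal.ofReal (6 * (ε / 8)) := by
    calc μ B ≤ μ A + μ A' + (μ B₁ + μ B₂) + (μ C₁ + μ C₂) :=
          (measure_union_le _ _).trans (add_le_add ((measure_union_le _ _).trans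
            (add_le_add (measure_union_le _ _) (measure_union_le _ _))) (measure_union_le _ _))
      _ ≤ ENNReal.ofReal (ε / 8) + ENNReal.ofReal (ε / 8) +
          (ENNReal.ofReal (ε / 8) + ENNReal.ofReal (ε / 8)) +
          (ENNReal.ofReal (ε / 8) + ENNReal.ofReal (ε / 8)) := by gcongr
      _ = ENNReal.ofReal (6 * (ε / 8)) := by
        repeat rw [← ENNReal.ofReal_add (by positivity) (by positivity)]
        congr 1
        ring
  -- B need not be measurable, so its measurable hull is removed; inner regularity costs a seventh
  -- ε/8.
  have hTm : MeasurableSet (F \ toMeasurable μ B) :=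
    hF.measurableSet.diff (measurableSet_toMeasurable μ B)
  obtain ⟨E, hEsub, hE, hEμ⟩ := hTm.exists_isCompact_sdiff_lt
    ((measure_mono sdiff_subset).trans_lt (hF.measure_lt_top (μ := μ))).ne (ENNReal.ofReal_pos.2 hε8).ne'
  have hEF : E ⊆ F := hEsub.trans sdiff_subset
  have hEB : ∀ t ∈ E, t ∉ B := fun t ht h => (hEsub ht).2 (subset_toMeasurable μ B h)
  refine ⟨s, hs, c, hc, hc0, E, hE, hEF, ?_, ?_, ?_⟩
  · calc μ (F \ E) ≤ μ (toMeasurable μ B ∪ ((F \ toMeasurable μ B) \ E)) :=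
          measure_mono fun t ht => by
            by_cases h : t ∈ toMeasurable μ B
            · exact .inl h
            · exact .inr ⟨⟨ht.1, h⟩, ht.2⟩
      _ ≤ μ (toMeasurable μ B) + μ ((F \ toMeasurable μ B) \ E) := measure_union_le _ _
      _ ≤ ENNReal.ofReal (6 * (ε / 8)) + ENNReal.ofReal (ε / 8) := by
        rw [measure_toMeasurable]
        gcongr
      _ < ENNReal.ofReal ε := by
        rw [← ENNReal.ofReal_add (by positivity) (by positivity)]
        exact (ENNReal.ofReal_lt_ofReal_iff hε).2 (by linarith)
  · refine essSup_le_of_ae_le _ (ae_restrict_of_forall_mem hE.measurableSet fun t ht => ?_)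
    refine ENNReal.ofReal_le_ofReal ?_
    by_contra! hlt
    refine hEB t ht (.inr (.inl ⟨⟨hEF ht, ?_⟩, hlt.le⟩))
    rintro (h | h)
    · exact hEB t ht (.inl (.inl (.inr h)))
    · exact hEB t ht (.inl (.inr (.inl h)))
  · refine essSup_le_of_ae_le _ (ae_restrict_of_forall_mem hE.measurableSet fun t ht => ?_)
    refine ENNReal.ofReal_le_ofReal ?_
    by_contra! hlt
    refine hEB t ht (.inr (.inr ⟨⟨hEF ht, ?_⟩, hlt.le⟩))
    rintro (h | h)
    · exact hEB t ht (.inl (.inl (.inl h)))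
    · exact hEB t ht (.inl (.inr (.inr h)))

end Necessity

/-! ### Elimination of the scalar -/

section Characterization

/-- As ω > 0, the supremum vanishes only when E is null, a condition independent of s. -/
theorem essSupTranslate_eq_zero (hpos : ∀ t, 0 < ω t) {E : Set G} {s s' : G}
    (h : essSupTranslate μ ω E s = 0) : essSupTranslate μ ω E s' = 0 := by
  have h1 := ENNReal.essSup_eq_zero_iff.1 h
  have h2 : ae (μ.restrict E) = ⊥ := by
    rw [← Filter.eventually_false_iff_eq_bot]
    filter_upwards [h1] with t ht
    exact (ENNReal.ofReal_pos.2 (hpos (s * t))).ne' ht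
  rw [essSupTranslate, ENNReal.essSup_eq_zero_iff, Filter.EventuallyEq, h2]
  exact Filter.eventually_bot

/-- Take c = 1 if a, b ≤ ε, c = b/ε if only b exceeds ε, and c = ε/a if a does. Simultaneous
vanishing of a and b excludes the product 0·∞. -/
theorem exists_balancing_scalar {a b : ℝ≥0∞} {ε : ℝ} (hε : 0 < ε)
    (hab : a * b ≤ ENNReal.ofReal (ε ^ 2)) (ha0 : a = 0 → b = 0) (hb0 : b = 0 → a = 0) :
    ∃ c : ℝ, 0 < c ∧ a ≤ ENNReal.ofReal (ε / c) ∧ b ≤ ENNReal.ofReal (ε * c) ∧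
      (b ≤ ENNReal.ofReal ε → c ≤ 1) ∧ (a ≤ ENNReal.ofReal ε → 1 ≤ c) := by
  by_cases hzero : a = 0
  · exact ⟨1, one_pos, by simp [hzero], by simp [ha0 hzero], by simp, by simp⟩
  have hbzero : b ≠ 0 := fun h => hzero (hb0 h)
  have hlt := hab.trans_lt ENNReal.ofReal_lt_top
  have ha : a ≠ ∞ := by
    rintro rfl
    simp [ENNReal.top_mul hbzero] at hlt
  have hb : b ≠ ∞ := by
    rintro rfl
    simp [ENNReal.mul_top hzero] at hlt
  lift a to NNReal using ha
  lift b to NNReal using hb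
  have ha' : 0 < (a : ℝ) := by
    simpa [pos_iff_ne_zero] using hzero
  have hb' : 0 < (b : ℝ) := by
    simpa [pos_iff_ne_zero] using hbzero
  have key : ∀ (x : NNReal) (y : ℝ), 0 ≤ y → ((x : ℝ≥0∞) ≤ ENNReal.ofReal y ↔ (x : ℝ) ≤ y) := by
    intro x y hy
    rw [← ENNReal.ofReal_coe_nnreal, ENNReal.ofReal_le_ofReal_iff hy]
  rw [← ENNReal.coe_mul, key _ _ (by positivity), NNReal.coe_mul] at hab
  rcases le_or_gt (a : ℝ) ε with h1 | h1
  · rcases le_or_gt (b : ℝ) ε with h2 | h2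
    · refine ⟨1, one_pos, ?_, ?_, by simp, by simp⟩ <;> rw [key _ _ (by positivity)] <;> simpa
    · refine ⟨b / ε, by positivity, ?_, ?_, ?_, ?_⟩
      · rw [key _ _ (by positivity), le_div_iff₀ (by positivity), ← mul_div_assoc,
          div_le_iff₀ hε]
        linarith
      · rw [key _ _ (by positivity), mul_div_cancel₀ _ hε.ne']
      · intro h
        exact absurd ((key _ _ hε.le).1 h) (not_le.2 h2)
      · exact fun _ => (one_le_div hε).2 h2.le
  · refine ⟨ε / a, by positivity, ?_, ?_, ?_, ?_⟩
    · rw [key _ _ (by positivity), div_div_cancel₀ hε.ne']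
    · rw [key _ _ (by positivity), ← mul_div_assoc, le_div_iff₀ ha']
      linarith
    · exact fun _ => (div_le_one ha').2 h1.le
    · intro h
      exact absurd ((key _ _ hε.le).1 h) (not_le.2 h1)

/-- The criterion with the scalar eliminated, for sets of scalars cut out by the optional bounds
`|c| ≤ 1` and `1 ≤ |c|`. -/
theorem scaledCriterion_iff (hpos : ∀ t, 0 < ω t) {Γ : Set ℂ} (lower upper : Prop)
    (hΓ : ∀ c : ℝ, 0 < c → (upper → c ≤ 1) → (lower → 1 ≤ c) → (c : ℂ) ∈ Γ)
    (hΓ' : ∀ c ∈ Γ, (upper → ‖c‖ ≤ 1) ∧ (lower → 1 ≤ ‖c‖)) :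
    ScaledCriterion μ ω Γ S ↔
      ∀ F : Set G, IsCompact F → ∀ ε : ℝ, 0 < ε →
        ∃ s ∈ S, ∃ E : Set G, IsCompact E ∧ E ⊆ F ∧ μ (F \ E) < ENNReal.ofReal ε ∧
          (lower → essSupTranslate μ ω E s < ENNReal.ofReal ε) ∧
          (upper → essSupTranslate μ ω E s⁻¹ < ENNReal.ofReal ε) ∧
          essSupTranslate μ ω E s * essSupTranslate μ ω E s⁻¹ < ENNReal.ofReal ε := by
  constructor
  · intro H F hF ε hε
    obtain ⟨ε', hε', h1, h2⟩ : ∃ ε' : ℝ, 0 < ε' ∧ ε' < ε ∧ ε' * ε' < ε := by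
      refine ⟨min (ε / 2) 1, by positivity, ?_, ?_⟩
      · linarith [min_le_left (ε / 2) 1]
      · have h0 : 0 < min (ε / 2) 1 := by positivity
        nlinarith [min_le_left (ε / 2) 1, min_le_right (ε / 2) 1]
    obtain ⟨s, hs, c, hc, hc0, E, hE, hEF, hμ, ha, hb⟩ := H F hF ε' hε'
    have hcn := norm_pos_iff.2 hc0
    have hlt : ∀ x : ℝ, x ≤ ε' → ENNReal.ofReal x < ENNReal.ofReal ε := fun x hx =>
      (ENNReal.ofReal_lt_ofReal_iff hε).2 (hx.trans_lt h1)
    refine ⟨s, hs, E, hE, hEF, hμ.trans (hlt _ le_rfl), fun h => ha.trans_lt (hlt _ ?_),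
      fun h => hb.trans_lt (hlt _ ?_), (mul_le_mul' ha hb).trans_lt ?_⟩
    · exact div_le_self hε'.le ((hΓ' c hc).2 h)
    · exact mul_le_of_le_one_right hε'.le ((hΓ' c hc).1 h)
    · rw [← ENNReal.ofReal_mul (by positivity), ENNReal.ofReal_lt_ofReal_iff hε]
      refine lt_of_eq_of_lt ?_ h2
      field_simp
  · intro H F hF ε hε
    -- The product must be at most ε², as balancing distributes it into two factors ε.
    obtain ⟨s, hs, E, hE, hEF, hμ, ha, hb, hab⟩ := H F hF (min ε (ε ^ 2)) (by positivity)
    have hle : ENNReal.ofReal (min ε (ε ^ 2)) ≤ ENNReal.ofReal ε :=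
      ENNReal.ofReal_le_ofReal (min_le_left _ _)
    obtain ⟨c, hc, h1, h2, h3, h4⟩ := exists_balancing_scalar hε
      (hab.le.trans (ENNReal.ofReal_le_ofReal (min_le_right _ _)))
      (essSupTranslate_eq_zero hpos) (essSupTranslate_eq_zero hpos)
    have hcn : ‖(c : ℂ)‖ = c := by simp [abs_of_pos hc]
    refine ⟨s, hs, c, hΓ c hc (fun h => h3 ((hb h).le.trans hle))
      (fun h => h4 ((ha h).le.trans hle)), by exact_mod_cast hc.ne', E, hE, hEF,
      hμ.trans_le hle, ?_, ?_⟩ <;> rwa [hcn]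

theorem hasDenseVector_iff_hasScaledDenseVector :
    HasDenseVector μ p ω S ↔ HasScaledDenseVector μ p ω {1} S := by
  have h : ∀ f, scaledOrbit μ p ω {1} S f = orbit μ p ω S f := fun f => by
    ext g
    simp [orbit, scaledOrbit]
  simp [HasDenseVector, HasScaledDenseVector, h]

/-- Existence of `(Γ, S)`-dense vectors when the translations by `S` commute. -/
theorem hasScaledDenseVector_iff [T2Space G] [NoncompactSpace G] (hp : p ≠ ∞)
    (hω : IsWeight μ p ω) (hadm : IsAdmissible μ S ω) (hcomm : ∀ x ∈ S, ∀ y ∈ S, x * y = y * x)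
    {Γ : Set ℂ} : HasScaledDenseVector μ p ω Γ S ↔ ScaledCriterion μ ω Γ S :=
  ⟨fun h => h.scaledCriterion hω hp hadm hcomm, fun h => h.hasScaledDenseVector hω hp hadm⟩

end Characterization

end WeightedTranslates

/-! ### The four cases -/

theorem corollary26 {G : Type*} [Group G] [TopologicalSpace G] [IsTopologicalGroup G]
    [T2Space G] [LocallyCompactSpace G] [SecondCountableTopology G] [NoncompactSpace G]
    [MeasurableSpace G] [BorelSpace G] (μ : Measure G) [μ.IsHaarMeasure]
    (p : ℝ≥0∞) [Fact (1 ≤ p)] (hp : p ≠ ∞) (S : Set G) (ω : G → ℝ)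
    (hω : WeightedTranslates.IsWeight μ p ω) (hadm : WeightedTranslates.IsAdmissible μ S ω)
    (hab : ∀ x ∈ Subgroup.closure S, ∀ y ∈ Subgroup.closure S, x * y = y * x) :
    (WeightedTranslates.HasDenseVector μ p ω S ↔
      ∀ F : Set G, IsCompact F → ∀ ε : ℝ, 0 < ε →
        ∃ s ∈ S, ∃ E : Set G, IsCompact E ∧ E ⊆ F ∧ μ (F \ E) < ENNReal.ofReal ε ∧
          WeightedTranslates.essSupTranslate μ ω E s < ENNReal.ofReal ε ∧
          WeightedTranslates.essSupTranslate μ ω E s⁻¹ < ENNReal.ofReal ε) ∧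
    (WeightedTranslates.HasScaledDenseVector μ p ω (Complex.ofReal '' Set.Icc 0 1) S ↔
      ∀ F : Set G, IsCompact F → ∀ ε : ℝ, 0 < ε →
        ∃ s ∈ S, ∃ E : Set G, IsCompact E ∧ E ⊆ F ∧ μ (F \ E) < ENNReal.ofReal ε ∧
          WeightedTranslates.essSupTranslate μ ω E s⁻¹ < ENNReal.ofReal ε ∧
          WeightedTranslates.essSupTranslate μ ω E s *
            WeightedTranslates.essSupTranslate μ ω E s⁻¹ < ENNReal.ofReal ε) ∧
    (WeightedTranslates.HasScaledDenseVector μ p ω (Complex.ofReal '' Set.Ici 1) S ↔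
      ∀ F : Set G, IsCompact F → ∀ ε : ℝ, 0 < ε →
        ∃ s ∈ S, ∃ E : Set G, IsCompact E ∧ E ⊆ F ∧ μ (F \ E) < ENNReal.ofReal ε ∧
          WeightedTranslates.essSupTranslate μ ω E s < ENNReal.ofReal ε ∧
          WeightedTranslates.essSupTranslate μ ω E s *
            WeightedTranslates.essSupTranslate μ ω E s⁻¹ < ENNReal.ofReal ε) ∧
    (WeightedTranslates.HasScaledDenseVector μ p ω Set.univ S ↔
      ∀ F : Set G, IsCompact F → ∀ ε : ℝ, 0 < ε →
        ∃ s ∈ S, ∃ E : Set G, IsCompact E ∧ E ⊆ F ∧ μ (F \ E) < ENNReal.ofReal ε ∧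
          WeightedTranslates.essSupTranslate μ ω E s *
            WeightedTranslates.essSupTranslate μ ω E s⁻¹ < ENNReal.ofReal ε) := by
  have hcomm : ∀ x ∈ S, ∀ y ∈ S, x * y = y * x := fun x hx y hy =>
    hab x (Subgroup.subset_closure hx) y (Subgroup.subset_closure hy)
  have key {Γ : Set ℂ} := WeightedTranslates.hasScaledDenseVector_iff (Γ := Γ) hp hω hadm hcomm
  refine ⟨?_, ?_, ?_, ?_⟩
  · rw [WeightedTranslates.hasDenseVector_iff_hasScaledDenseVector, key,
      WeightedTranslates.scaledCriterion_iff hω.1 True True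
        (fun c _ h1 h2 => by simp [le_antisymm (h1 trivial) (h2 trivial)])
        (fun c hc => by simp [Set.mem_singleton_iff.1 hc])]
    refine forall₂_congr fun F hF => ⟨fun H ε hε => ?_, fun H ε hε => ?_⟩
    · obtain ⟨s, hs, E, hE, hEF, hμ, ha, hb, -⟩ := H ε hε
      exact ⟨s, hs, E, hE, hEF, hμ, ha trivial, hb trivial⟩
    · obtain ⟨s, hs, E, hE, hEF, hμ, ha, hb⟩ := H (min ε 1) (by positivity)
      have hle : ENNReal.ofReal (min ε 1) ≤ ENNReal.ofReal ε :=
        ENNReal.ofReal_le_ofReal (min_le_left _ _)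
      refine ⟨s, hs, E, hE, hEF, hμ.trans_le hle, fun _ => ha.trans_le hle,
        fun _ => hb.trans_le hle, lt_of_le_of_lt ?_ (hb.trans_le hle)⟩
      refine mul_le_of_le_one_left' (ha.le.trans ?_)
      simp
  · rw [key, WeightedTranslates.scaledCriterion_iff hω.1 False True]
    · simp
    · exact fun c hc h1 _ => ⟨c, ⟨hc.le, h1 trivial⟩, rfl⟩
    · rintro _ ⟨c, ⟨hc0, hc1⟩, rfl⟩
      simpa [abs_of_nonneg hc0] using hc1
  · rw [key, WeightedTranslates.scaledCriterion_iff hω.1 True False]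
    · simp
    · exact fun c _ _ h2 => ⟨c, h2 trivial, rfl⟩
    · rintro _ ⟨c, hc, rfl⟩
      have hc' : (1 : ℝ) ≤ c := hc
      simpa [abs_of_nonneg (zero_le_one.trans hc')] using hc'
  · rw [key, WeightedTranslates.scaledCriterion_iff hω.1 False False]
    · simp
    · simp
    · simp
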